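/- For a probability $\alpha$ on $\mathbb{R}^d$ write $\alpha\in FT_d$ if $\int_{\mathbb{R}^d}\log(1+\|x\|)\,\alpha(dx)<\infty$. For $\alpha\in FT_d$ and $t>0$ let $\mu(t\alpha)$ be the distribution of $$X_t=\sum_{k\ge 1}W_kB_k,\qquad W_k=Y_k\prod_{j<k}(1-Y_j),$$ where $B_1,Y_1,B_2,Y_2,\dots$ are independent with $B_k\sim\alpha$ and $Y_k\sim\beta(1,t)(dy)=t(1-y)^{t-1}\mathbf 1_{(0,1)}(y)\,dy$ (this series converges absolutely almost surely; $X_t$ is the mean of a Dirichlet random probability with parameter $t\alpha$). A probability on $\mathbb{R}$ is called Cauchy if it has density $\frac{1}{\pi}\frac{b}{(x-a)^2+b^2}$ for some $a\in\mathbb{R}$, $b>0$, and Dirac if it is $\delta_a$ for some $a\in\mathbb{R}$. A probability on $\mathbb{R}^d$ is called Cauchy in $\mathbb{R}^d$ if its image under every linear form $x\mapsto\langle f,x\rangle$, $f\in\mathbb{R}^d$, is Cauchy or Dirac on $\mathbb{R}$. **Proposition 6.1.** 1. Let $\alpha\in FT_1$, let $y(z)=\int_{\mathbb{R}}\frac{\alpha(dw)}{w-z}$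 for $\operatorname{Im}z>0$ be its Stieltjes transform, and let $n\ge 1$ be an integer. Then $\mu(n\alpha)=\alpha$ if and only if $$n\,y(z)\,y^{(n-1)}(z)=y^{(n)}(z)\qquad\text{for all } z \text{ with } \operatorname{Im}z>0.$$ 2. For $n=1$ and for $n=2$, either of these two equivalent conditions implies that $\alpha$ is Cauchy or Dirac. 3. Let $d$ be a nonnegative integer and $\alpha\in FT_d$. Then $\mu(\alpha)=\alpha$ if and only if $\alpha$ is Cauchy in $\mathbb{R}^d$, and likewise $\mu(2\alpha)=\alpha$ if and only if $\alpha$ is Cauchy in $\mathbb{R}^d$. -/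

import Mathlib

open MeasureTheory ProbabilityTheory
open scoped NNReal

/-- The stick-breaking weight `W n = Y n * ∏ j < n, (1 - Y j)` attached to a sequence `Y`
(indexed from `0`). -/
noncomputable def stickBreakingWeight (Y : ℕ → ℝ) (n : ℕ) : ℝ :=
  Y n * ∏ j ∈ Finset.range n, (1 - Y j)

section Law

variable {E : Type*} [NormedAddCommGroup E] [NormedSpace ℝ E] [MeasurableSpace E]

/-- The integrability condition defining the class `FT`: `∫ log (1 + ‖x‖) α(dx) < ∞`. -/
def MemFT (α : Measure E) : Prop :=
  Integrable (fun x : E => Real.log (1 + ‖x‖)) α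

/-- The mean `∑ n, W n • B n` of the purely atomic measure `∑ n, W n • δ_{B n}` built by
stick breaking from a sequence `ω n = (Y n, B n)`. -/
noncomputable def stickBreakingMean (ω : ℕ → ℝ × E) : E :=
  ∑' n, stickBreakingWeight (fun k => (ω k).1) n • (ω n).2

/-- The law `μ(tα)` of the mean `X_t = ∑ n, W n • B n` of a Dirichlet random probability with
governing probability `α` and intensity `t > 0`. Here the variables `Y 0, B 0, Y 1, B 1, …` are
independent, with `Y n ∼ β(1,t)` and `B n ∼ α`, realised on the canonical product space.
(Meaningful only for `t > 0` and a probability `α`, when the factors are probabilities.) -/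
noncomputable def dirichletMeanLaw (t : ℝ) (α : Measure E) : Measure E :=
  (Measure.infinitePi fun _ : ℕ => (betaMeasure 1 t).prod α).map stickBreakingMean

end Law

/-- The Stieltjes transform `y(z) = ∫ α(dw) / (w - z)` of a measure on the real line. -/
noncomputable def stieltjesTransform (α : Measure ℝ) (z : ℂ) : ℂ :=
  ∫ w : ℝ, 1 / ((w : ℂ) - z) ∂α

/-- Cross-check: this is Mathlib's resolvent transform, with real measure and complex argument. -/
theorem stieltjesTransform_eq_resolventTransform (α : Measure ℝ) (z : ℂ) :
    stieltjesTransform α z = resolventTransform α z := by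
  simp [stieltjesTransform, resolventTransform_apply, resolvent, Ring.inverse_eq_inv']

/-- A measure on `ℝ` is a (nondegenerate) Cauchy distribution if its density is
`b / (π ((x - a)² + b²))` for some real `a` and some `b > 0`. -/
def IsRealCauchy (α : Measure ℝ) : Prop :=
  ∃ (a : ℝ) (b : ℝ≥0), 0 < b ∧ α = cauchyMeasure a b

/-- A measure on `ℝ` is Dirac if it is the unit mass at some point. -/
def IsRealDirac (α : Measure ℝ) : Prop :=
  ∃ a : ℝ, α = Measure.dirac a

/-- A law on `ℝ^d` is Cauchy if the image under each linear form `x ↦ ⟪f, x⟫` is either Dirac or a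
one-dimensional Cauchy distribution. -/
def IsCauchy {d : ℕ} (α : Measure (EuclideanSpace ℝ (Fin d))) : Prop :=
  ∀ f : EuclideanSpace ℝ (Fin d),
    IsRealCauchy (α.map fun x => inner ℝ f x) ∨ IsRealDirac (α.map fun x => inner ℝ f x)

open Filter Topology Set

/-! Write S_n(z) for the integral of (w - z)^(-n). Since y^(n) = n! S_{n+1}, the equation n y
y^(n-1) = y^(n) says S_1 S_n = S_{n+1} for α. Stick breaking gives X = Y B + (1 - Y) X' in law, with
independent terms and X' distributed as X. For Y ∼ β(1,n), averaging (Y b + (1 - Y) x - z)^(-n-1)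
over Y gives exactly (b - z)^(-1) (x - z)^(-n). Hence S_{n+1}(μ) = S_1(α) S_n(μ) for μ = μ(nα)
(`stieltjesPow_dirichletMeanLaw`), and μ = α forces the equation.

Conversely, the equation makes S_n(μ) and S_n(α) solutions of the same linear ODE F' = n y F with
the same behaviour at i∞, so they coincide. A probability is determined by S_n: S_n determines S_1
by integrating down from infinity, and Stieltjes inversion recovers the measure
(`eq_of_stieltjesPow_eq`).

For n = 1 the equation is the Riccati equation y' = y^2, so y = 1/(c - z), the transform of a Cauchy
or Dirac law. For n = 2 it says that S_1^2 - S_2 has zero derivative; this difference vanishes at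
infinity, which reduces to n = 1. In dimension d, Dirichlet means commute with linear forms, and the
images under linear forms determine the law. -/

/-- The generalized Stieltjes transform `∫ (w - z)⁻¹ ^ n α(dw)`. -/
noncomputable def stieltjesPow (α : Measure ℝ) (n : ℕ) (z : ℂ) : ℂ :=
  ∫ w : ℝ, ((w : ℂ) - z)⁻¹ ^ n ∂α

/-! ### Resolvent powers: bounds, derivatives, behaviour at i∞ -/

theorem stieltjesPow_one (α : Measure ℝ) : stieltjesPow α 1 = stieltjesTransform α := by
  ext z; simp [stieltjesPow, stieltjesTransform]

theorem im_le_norm_ofReal_sub (w : ℝ) (z : ℂ) : z.im ≤ ‖(w : ℂ) - z‖ := by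
  have := Complex.abs_im_le_norm ((w : ℂ) - z)
  simp only [Complex.sub_im, Complex.ofReal_im, zero_sub, abs_neg] at this
  exact (le_abs_self _).trans this

theorem ofReal_sub_ne_zero {z : ℂ} (hz : 0 < z.im) (w : ℝ) : (w : ℂ) - z ≠ 0 :=
  norm_pos_iff.1 (hz.trans_le (im_le_norm_ofReal_sub w z))

theorem norm_inv_pow_le {z : ℂ} {r : ℝ} (hr : 0 < r) (hz : r ≤ z.im) (w : ℝ) (n : ℕ) :
    ‖((w : ℂ) - z)⁻¹ ^ n‖ ≤ r⁻¹ ^ n := by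
  rw [norm_pow, norm_inv]
  have := hz.trans (im_le_norm_ofReal_sub w z)
  gcongr

theorem measurable_inv_pow (z : ℂ) (n : ℕ) :
    Measurable fun w : ℝ => ((w : ℂ) - z)⁻¹ ^ n := by fun_prop

section Stieltjes

variable {α : Measure ℝ}

theorem integrable_inv_pow [IsFiniteMeasure α] {z : ℂ} (hz : 0 < z.im) (n : ℕ) :
    Integrable (fun w : ℝ => ((w : ℂ) - z)⁻¹ ^ n) α :=
  .of_bound (measurable_inv_pow z n).aestronglyMeasurable (z.im⁻¹ ^ n)
    (.of_forall fun w => norm_inv_pow_le hz le_rfl w n)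

theorem norm_stieltjesPow_le [IsProbabilityMeasure α] {z : ℂ} (hz : 0 < z.im) (n : ℕ) :
    ‖stieltjesPow α n z‖ ≤ z.im⁻¹ ^ n := by
  have := norm_integral_le_of_norm_le_const (μ := α)
    (.of_forall fun w => norm_inv_pow_le hz le_rfl w n)
  simpa [stieltjesPow] using this

theorem hasDerivAt_inv_pow {z : ℂ} (hz : 0 < z.im) (w : ℝ) (n : ℕ) :
    HasDerivAt (fun z : ℂ => ((w : ℂ) - z)⁻¹ ^ n) (n * ((w : ℂ) - z)⁻¹ ^ (n + 1)) z := by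
  have h0 := ofReal_sub_ne_zero hz w
  have h := (((hasDerivAt_id z).const_sub (w : ℂ)).inv h0).pow n
  refine h.congr_deriv ?_
  rcases n with _ | n
  · simp
  · simp only [id, Pi.inv_apply, Nat.add_sub_cancel, inv_pow]
    field_simp
    ring

theorem hasDerivAt_stieltjesPow [IsFiniteMeasure α] {z : ℂ} (hz : 0 < z.im) (n : ℕ) :
    HasDerivAt (stieltjesPow α n) (n * stieltjesPow α (n + 1) z) z := by
  -- Staying above height Im z / 2 gives a bound on the differentiated integrand uniform in u and w.
  have hU : {u : ℂ | z.im / 2 < u.im} ∈ 𝓝 z :=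
    (isOpen_lt continuous_const Complex.continuous_im).mem_nhds (by simp; linarith)
  have h := (hasDerivAt_integral_of_dominated_loc_of_deriv_le (μ := α)
    (F := fun u (w : ℝ) => ((w : ℂ) - u)⁻¹ ^ n)
    (F' := fun u (w : ℝ) => (n : ℂ) * ((w : ℂ) - u)⁻¹ ^ (n + 1))
    (bound := fun _ => n * (z.im / 2)⁻¹ ^ (n + 1)) hU
    (.of_forall fun u => (measurable_inv_pow u n).aestronglyMeasurable)
    (integrable_inv_pow hz n)
    ((measurable_inv_pow z (n + 1)).const_mul _).aestronglyMeasurable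
    (.of_forall fun w u hu => ?_) (integrable_const _)
    (.of_forall fun w u hu => hasDerivAt_inv_pow ((half_pos hz).trans hu) w n)).2
  · rwa [integral_const_mul] at h
  · rw [norm_mul, Complex.norm_natCast]
    gcongr
    exact norm_inv_pow_le (half_pos hz) (le_of_lt hu) w _

theorem isOpen_setOf_im_pos : IsOpen {z : ℂ | 0 < z.im} :=
  isOpen_lt continuous_const Complex.continuous_im

theorem isPreconnected_upperHalfPlane : IsPreconnected {z : ℂ | 0 < z.im} :=
  (convex_halfSpace_im_gt 0).isPreconnected

theorem differentiableOn_stieltjesPow [IsFiniteMeasure α] (n : ℕ) :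
    DifferentiableOn ℂ (stieltjesPow α n) {z : ℂ | 0 < z.im} := fun _ hz =>
  (hasDerivAt_stieltjesPow hz n).differentiableAt.differentiableWithinAt

theorem iteratedDeriv_stieltjesTransform [IsFiniteMeasure α] (n : ℕ) {z : ℂ} (hz : 0 < z.im) :
    iteratedDeriv n (stieltjesTransform α) z = n.factorial * stieltjesPow α (n + 1) z := by
  induction n generalizing z with
  | zero => simp [stieltjesPow_one]
  | succ n ih =>
    have : iteratedDeriv n (stieltjesTransform α) =ᶠ[𝓝 z]
        fun z => n.factorial * stieltjesPow α (n + 1) z := by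
      filter_upwards [isOpen_setOf_im_pos.mem_nhds hz] with u hu using ih hu
    rw [iteratedDeriv_succ, this.deriv_eq,
      ((hasDerivAt_stieltjesPow hz (n + 1)).const_mul _).deriv, Nat.factorial_succ]
    push_cast; ring

theorem im_ofReal_mul_I (s : ℝ) : ((s : ℂ) * Complex.I).im = s := by simp

theorem tendsto_stieltjesPow_zero [IsProbabilityMeasure α] (n : ℕ) :
    Tendsto (fun s : ℝ => stieltjesPow α (n + 1) (s * Complex.I)) atTop (𝓝 0) := by
  have h : Tendsto (fun s : ℝ => s⁻¹ ^ (n + 1)) atTop (𝓝 0) := by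
    simpa using (tendsto_inv_atTop_zero (𝕜 := ℝ)).pow (n + 1)
  refine squeeze_zero_norm' ?_ h
  filter_upwards [eventually_gt_atTop 0] with s hs
  simpa using norm_stieltjesPow_le (α := α) (z := s * Complex.I) (by simpa using hs) (n + 1)

/-- On the imaginary axis |z| = Im z ≤ |w - z|, so z/(w - z) is bounded by 1 and tends to -1:
dominated convergence applies without any moment of α. This normalisation later fixes the constant
in the ODE argument. -/
theorem tendsto_pow_mul_stieltjesPow [IsProbabilityMeasure α] (n : ℕ) :
    Tendsto (fun s : ℝ => ((s : ℂ) * Complex.I) ^ n * stieltjesPow α n (s * Complex.I)) atTop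
      (𝓝 ((-1) ^ n)) := by
  have h : Tendsto (fun s : ℝ => ∫ w : ℝ,
      ((s : ℂ) * Complex.I) ^ n * ((w : ℂ) - s * Complex.I)⁻¹ ^ n ∂α) atTop
      (𝓝 (∫ _ : ℝ, (-1) ^ n ∂α)) := by
    refine tendsto_integral_filter_of_dominated_convergence (fun _ => 1) ?_ ?_
      (integrable_const _) ?_
    · exact .of_forall fun s => ((measurable_inv_pow _ n).const_mul _).aestronglyMeasurable
    · filter_upwards [eventually_gt_atTop 0] with s hs
      refine .of_forall fun w => ?_
      rw [← mul_pow, norm_pow, norm_mul, norm_inv, ← div_eq_mul_inv]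
      refine pow_le_one₀ (by positivity) (div_le_one_of_le₀ ?_ (norm_nonneg _))
      have := im_le_norm_ofReal_sub w (s * Complex.I)
      simpa [abs_of_pos hs] using this
    · refine .of_forall fun w => ?_
      simp_rw [← mul_pow]
      refine Tendsto.pow ?_ n
      have h1 : Tendsto (fun s : ℝ => ((w / s : ℝ) : ℂ) - Complex.I) atTop (𝓝 (0 - Complex.I)) := by
        refine Tendsto.sub_const ?_ _
        rw [← Complex.ofReal_zero]
        exact (Complex.continuous_ofReal.tendsto _).comp (tendsto_const_nhds.div_atTop tendsto_id)
      have h2 := (h1.inv₀ (by simp)).const_mul Complex.I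
      have e : Complex.I * (0 - Complex.I)⁻¹ = -1 := by simp
      rw [e] at h2
      refine h2.congr' ?_
      filter_upwards [eventually_gt_atTop 0] with s hs
      have hs' : (s : ℂ) ≠ 0 := by exact_mod_cast hs.ne'
      have : ((w / s : ℝ) : ℂ) - Complex.I = ((w : ℂ) - s * Complex.I) / s := by
        push_cast; field_simp
      rw [this, inv_div]; ring
  simpa [integral_const_mul, stieltjesPow] using h

/-! ### Stieltjes inversion through the Cauchy kernel -/

theorem im_inv_ofReal_sub (w x : ℝ) (ε : ℝ≥0) :
    (((w : ℂ) - (x + ε * Complex.I))⁻¹).im = Real.pi * cauchyPDFReal w ε x := by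
  rw [cauchyPDFReal_def, Complex.inv_im, Complex.normSq_apply]
  have := Real.pi_ne_zero
  simp
  field_simp
  ring

theorem im_ofReal_add_mul_I (x : ℝ) (ε : ℝ≥0) : ((x : ℂ) + ε * Complex.I).im = ε := by simp

theorem im_stieltjesTransform [IsFiniteMeasure α] (x : ℝ) {ε : ℝ≥0} (hε : 0 < ε) :
    (stieltjesTransform α (x + ε * Complex.I)).im = Real.pi * ∫ w, cauchyPDFReal w ε x ∂α := by
  have h := integrable_inv_pow (α := α) (z := x + ε * Complex.I) (by simpa using hε) 1
  simp only [pow_one] at h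
  rw [stieltjesTransform, ← integral_const_mul]
  simp_rw [one_div, ← im_inv_ofReal_sub]
  exact (integral_im h).symm

/-- The substitution x = w + εu turns the kernel of scale ε into a fixed density, so that ε → 0
becomes a dominated-convergence statement. -/
theorem integral_mul_cauchyPDFReal (f : ℝ → ℝ) (w : ℝ) {ε : ℝ≥0} (hε : 0 < ε) :
    ∫ x, f x * cauchyPDFReal w ε x = ∫ u, f (w + ε * u) * cauchyPDFReal 0 1 u := by
  have hε' : (0 : ℝ) < ε := hε
  have h := Measure.integral_comp_mul_left
    (fun x => f (w + x) * (ε * cauchyPDFReal w ε (w + x))) (ε : ℝ)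
  rw [integral_add_left_eq_self (fun x => f x * (ε * cauchyPDFReal w ε x)) w] at h
  have e : ∀ u : ℝ, (ε : ℝ) * cauchyPDFReal w ε (w + ε * u) = cauchyPDFReal 0 1 u := by
    intro u
    simp only [cauchyPDFReal_def, NNReal.coe_one]
    have : (0 : ℝ) < u ^ 2 + 1 := by positivity
    have h2 : (w + ε * u - w) ^ 2 + (ε : ℝ) ^ 2 = ε ^ 2 * (u ^ 2 + 1) := by ring
    rw [h2]
    field_simp
    simp
  simp_rw [e] at h
  rw [h, abs_of_pos (inv_pos.2 hε'), smul_eq_mul, ← integral_const_mul]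
  congr with x
  field_simp

theorem continuous_uncurry_cauchyPDFReal {ε : ℝ≥0} (hε : 0 < ε) :
    Continuous fun p : ℝ × ℝ => cauchyPDFReal p.2 ε p.1 := by
  have hε' : (0 : ℝ) < ε := hε
  simp only [cauchyPDFReal_def]
  refine Continuous.mul (by fun_prop) (Continuous.inv₀ (by fun_prop) fun p => by positivity)

theorem integral_mul_im_stieltjesTransform [IsProbabilityMeasure α] (f : BoundedContinuousFunction ℝ ℝ)
    {ε : ℝ≥0} (hε : 0 < ε) :
    ∫ x, f x * (stieltjesTransform α (x + ε * Complex.I)).im =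
      Real.pi * ∫ w, (∫ u, f (w + ε * u) * cauchyPDFReal 0 1 u) ∂α := by
  have hc : Continuous fun p : ℝ × ℝ => f p.2 * cauchyPDFReal p.1 ε p.2 :=
    (f.continuous.comp continuous_snd).mul
      ((continuous_uncurry_cauchyPDFReal hε).comp continuous_swap)
  have hi : ∀ w, Integrable fun x => f x * cauchyPDFReal w ε x := fun w =>
    (integrable_cauchyPDFReal w).bdd_mul f.continuous.aestronglyMeasurable
      (.of_forall f.norm_coe_le_norm)
  have hI : Integrable (fun p : ℝ × ℝ => f p.2 * cauchyPDFReal p.1 ε p.2) (α.prod volume) := by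
    refine (integrable_prod_iff hc.aestronglyMeasurable).2 ⟨.of_forall hi, ?_⟩
    refine .of_bound (hc.norm.aestronglyMeasurable.integral_prod_right') ‖f‖ (.of_forall fun w => ?_)
    rw [Real.norm_of_nonneg (integral_nonneg fun _ => norm_nonneg _)]
    calc ∫ x, ‖f x * cauchyPDFReal w ε x‖ ≤ ∫ x, ‖f‖ * cauchyPDFReal w ε x := by
          refine integral_mono (hi w).norm ((integrable_cauchyPDFReal w).const_mul _) fun x => ?_
          have := cauchyPDF_pos w hε.ne' x
          simp only [norm_mul, Real.norm_of_nonneg this.le]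
          gcongr
          exact f.norm_coe_le_norm x
      _ = ‖f‖ := by rw [integral_const_mul, integral_cauchyPDFReal_eq_one w hε.ne', mul_one]
  simp_rw [im_stieltjesTransform _ hε]
  rw [integral_congr_ae (.of_forall fun w => (integral_mul_cauchyPDFReal f w hε).symm)]
  rw [integral_integral_swap hI, ← integral_const_mul]
  congr with x
  rw [integral_const_mul]
  ring

/-- Dominated convergence twice: in u against ‖f‖ times the standard Cauchy density, then in w
against the constant ‖f‖. -/
theorem tendsto_integral_cauchy_smoothing [IsProbabilityMeasure α]
    (f : BoundedContinuousFunction ℝ ℝ) :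
    Tendsto (fun n : ℕ => ∫ w,
      (∫ u, f (w + ((n + 1 : ℝ≥0)⁻¹ : ℝ≥0) * u) * cauchyPDFReal 0 1 u) ∂α)
      atTop (𝓝 (∫ w, f w ∂α)) := by
  have hi : ∀ g : ℝ → ℝ, Continuous g → (∀ x, ‖g x‖ ≤ ‖f‖) →
      Integrable fun u => g u * cauchyPDFReal 0 1 u := fun g hg hb =>
    (integrable_cauchyPDFReal 0).bdd_mul hg.aestronglyMeasurable (.of_forall hb)
  have hb : ∀ x u, ‖f x * cauchyPDFReal 0 1 u‖ ≤ ‖f‖ * cauchyPDFReal 0 1 u := fun x u => by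
    have := cauchyPDF_pos 0 one_ne_zero u
    rw [norm_mul, Real.norm_of_nonneg this.le]
    gcongr
    exact f.norm_coe_le_norm x
  have h1 := integral_cauchyPDFReal_eq_one 0 one_ne_zero
  have hm := measurable_cauchyPDFReal 0 1
  refine tendsto_integral_of_dominated_convergence (μ := α) (fun _ => ‖f‖)
    (fun n => ?_) (integrable_const _) (fun n => .of_forall fun w => ?_) (.of_forall fun w => ?_)
  · have : Measurable fun p : ℝ × ℝ =>
        f (p.1 + ((n + 1 : ℝ≥0)⁻¹ : ℝ≥0) * p.2) * cauchyPDFReal 0 1 p.2 := by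
      have := f.continuous.measurable
      fun_prop
    exact this.aestronglyMeasurable.integral_prod_right'
  · refine (norm_integral_le_of_norm_le ((integrable_cauchyPDFReal 0 (γ := 1)).const_mul ‖f‖)
      (.of_forall fun u => hb _ u)).trans ?_
    rw [integral_const_mul, h1, mul_one]
  · have : f w = ∫ u, f w * cauchyPDFReal 0 1 u := by rw [integral_const_mul, h1, mul_one]
    rw [this]
    refine tendsto_integral_of_dominated_convergence (fun u => ‖f‖ * cauchyPDFReal 0 1 u)
      (fun n => ?_) ((integrable_cauchyPDFReal 0).const_mul _) (fun n => .of_forall fun u => hb _ u)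
      (.of_forall fun u => ?_)
    · exact (hi (fun u => f (w + ((n + 1 : ℝ≥0)⁻¹ : ℝ≥0) * u)) (by fun_prop)
        fun x => f.norm_coe_le_norm _).aestronglyMeasurable
    · refine Tendsto.mul_const _ ((f.continuous.tendsto w).comp ?_)
      have h0 : Tendsto (fun n : ℕ => (((n + 1 : ℝ≥0)⁻¹ : ℝ≥0) : ℝ)) atTop (𝓝 0) := by
        simpa using tendsto_one_div_add_atTop_nhds_zero_nat (𝕜 := ℝ)
      simpa using (h0.mul_const u).const_add w

/-- A probability on the line is determined by its Stieltjes transform on the upper half-plane. -/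
theorem eq_of_stieltjesTransform_eq {μ : Measure ℝ} [IsProbabilityMeasure α]
    [IsProbabilityMeasure μ]
    (h : ∀ z : ℂ, 0 < z.im → stieltjesTransform α z = stieltjesTransform μ z) : α = μ := by
  refine ext_of_forall_integral_eq_of_IsFiniteMeasure fun f => ?_
  refine tendsto_nhds_unique (tendsto_integral_cauchy_smoothing f) ?_
  refine (tendsto_integral_cauchy_smoothing (α := μ) f).congr fun n => ?_
  have hε : (0 : ℝ≥0) < (n + 1 : ℝ≥0)⁻¹ := by positivity
  -- Both smoothed integrals equal, up to the factor π, the integral of f against the imaginary part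
  -- of the common transform at height ε.
  refine mul_left_cancel₀ Real.pi_ne_zero ?_
  rw [← integral_mul_im_stieltjesTransform f hε, ← integral_mul_im_stieltjesTransform f hε]
  congr with x
  rw [h]
  rw [im_ofReal_add_mul_I]
  exact hε

/-- The `n`-th power version of `eq_of_stieltjesTransform_eq`. -/
theorem eq_of_stieltjesPow_eq {μ : Measure ℝ} [IsProbabilityMeasure α]
    [IsProbabilityMeasure μ] (n : ℕ)
    (h : ∀ z : ℂ, 0 < z.im → stieltjesPow α (n + 1) z = stieltjesPow μ (n + 1) z) : α = μ := by
  induction n with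
  | zero => exact eq_of_stieltjesTransform_eq fun z hz => by simpa [stieltjesPow_one] using h z hz
  | succ n ih =>
    refine ih fun z hz => ?_
    -- Equal derivatives leave a constant a, which is killed by decay along the imaginary axis.
    obtain ⟨a, ha⟩ := isOpen_setOf_im_pos.exists_eq_add_of_deriv_eq
      isPreconnected_upperHalfPlane (differentiableOn_stieltjesPow (α := α) (n + 1))
      (differentiableOn_stieltjesPow (α := μ) (n + 1)) fun u hu => by
        rw [(hasDerivAt_stieltjesPow hu _).deriv, (hasDerivAt_stieltjesPow hu _).deriv, h u hu]
    have h0 := (tendsto_stieltjesPow_zero (α := μ) n).add_const a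
    have h1 := (tendsto_stieltjesPow_zero (α := α) n).congr' (f₂ := fun s : ℝ =>
      stieltjesPow μ (n + 1) (s * Complex.I) + a) (by
        filter_upwards [eventually_gt_atTop 0] with s hs
        exact ha (by simpa using hs))
    have : a = 0 := by simpa using tendsto_nhds_unique h0 h1
    simpa [this] using ha hz

/-! ### The Stieltjes transform of a Cauchy law -/

theorem tendsto_log_ofReal_sub_atTop (u : ℂ) :
    Tendsto (fun w : ℝ => Complex.log (w - u) - Real.log w) atTop (𝓝 0) := by
  have h : Tendsto (fun w : ℝ => 1 - u * (w⁻¹ : ℝ)) atTop (𝓝 (1 - u * (0 : ℝ))) :=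
    (((Complex.continuous_ofReal.tendsto _).comp tendsto_inv_atTop_zero).const_mul u).const_sub 1
  simp only [Complex.ofReal_zero, mul_zero, sub_zero] at h
  have h2 := (continuousAt_clog Complex.one_mem_slitPlane).tendsto.comp h
  rw [Complex.log_one] at h2
  refine h2.congr' ?_
  filter_upwards [eventually_gt_atTop 0, h.eventually_ne one_ne_zero] with w hw hne
  have hw' : (w : ℂ) ≠ 0 := by exact_mod_cast hw.ne'
  have e : (w : ℂ) - u = w * (1 - u * (w⁻¹ : ℝ)) := by push_cast; field_simp
  rw [e, Complex.log_ofReal_mul hw hne]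
  simp

/-- After factoring out w, the argument of the logarithm tends to -1, on the branch cut. The set `s`
records the side of approach, hence whether the limit is πi or -πi. -/
theorem tendsto_log_neg_ofReal_sub_atTop {u l : ℂ} {s : Set ℂ}
    (hl : Tendsto Complex.log (𝓝[s] (-1)) (𝓝 l))
    (hs : ∀ w : ℝ, 0 < w → -1 - u * (w⁻¹ : ℝ) ∈ s) :
    Tendsto (fun w : ℝ => Complex.log (-w - u) - Real.log w) atTop (𝓝 l) := by
  have h : Tendsto (fun w : ℝ => -1 - u * (w⁻¹ : ℝ)) atTop (𝓝 (-1 - u * (0 : ℝ))) :=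
    (((Complex.continuous_ofReal.tendsto _).comp tendsto_inv_atTop_zero).const_mul u).const_sub _
  simp only [Complex.ofReal_zero, mul_zero, sub_zero] at h
  have h1 : Tendsto (fun w : ℝ => -1 - u * (w⁻¹ : ℝ)) atTop (𝓝[s] (-1)) :=
    tendsto_nhdsWithin_iff.2 ⟨h, by filter_upwards [eventually_gt_atTop 0] with w hw using hs w hw⟩
  refine (hl.comp h1).congr' ?_
  filter_upwards [eventually_gt_atTop 0, h.eventually_ne (neg_ne_zero.2 one_ne_zero)] with w hw hne
  have hw' : (w : ℂ) ≠ 0 := by exact_mod_cast hw.ne'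
  have e : -(w : ℂ) - u = w * (-1 - u * (w⁻¹ : ℝ)) := by push_cast; field_simp
  rw [e, Complex.log_ofReal_mul hw hne]
  simp

theorem tendsto_log_neg_ofReal_sub_of_im_pos {u : ℂ} (hu : 0 < u.im) :
    Tendsto (fun w : ℝ => Complex.log (-w - u) - Real.log w) atTop (𝓝 (-(Real.pi * Complex.I))) := by
  refine tendsto_log_neg_ofReal_sub_atTop (s := {z | z.im < 0}) ?_ fun w hw => ?_
  · simpa using Complex.tendsto_log_nhdsWithin_im_neg_of_re_neg_of_im_zero
      (z := -1) (by simp) (by simp)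
  · have := mul_pos hu (inv_pos.2 hw)
    simpa [← Complex.ofReal_inv] using this

theorem tendsto_log_neg_ofReal_sub_of_im_neg {u : ℂ} (hu : u.im < 0) :
    Tendsto (fun w : ℝ => Complex.log (-w - u) - Real.log w) atTop (𝓝 (Real.pi * Complex.I)) := by
  refine tendsto_log_neg_ofReal_sub_atTop (s := {z | 0 ≤ z.im}) ?_ fun w hw => ?_
  · simpa using Complex.tendsto_log_nhdsWithin_im_nonneg_of_re_neg_of_im_zero
      (z := -1) (by simp) (by simp)
  · have := mul_neg_of_neg_of_pos hu (inv_pos.2 hw)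
    simpa [← Complex.ofReal_inv] using this.le

theorem ofReal_sub_ne_zero_of_im_ne_zero {z : ℂ} (hz : z.im ≠ 0) (w : ℝ) : (w : ℂ) - z ≠ 0 := by
  intro h
  apply hz
  have := congrArg Complex.im h
  simpa using this

theorem hasDerivAt_log_ofReal_sub {u : ℂ} (hu : u.im ≠ 0) (w : ℝ) :
    HasDerivAt (fun w : ℝ => Complex.log (w - u)) ((w : ℂ) - u)⁻¹ w := by
  have h1 : HasDerivAt (fun w : ℝ => (w : ℂ) - u) 1 w :=
    ((hasDerivAt_id w).ofReal_comp).sub_const u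
  have h2 := h1.clog_real (Or.inr (by simpa using hu))
  simpa using h2

theorem integrable_norm_inv_sq {u : ℂ} (hu : u.im ≠ 0) :
    Integrable fun w : ℝ => ‖((w : ℂ) - u)⁻¹‖ ^ 2 := by
  have h := ((integrable_cauchyPDFReal u.re (γ := ‖u.im‖₊)).const_mul (Real.pi * |u.im|⁻¹))
  refine h.congr (.of_forall fun w => ?_)
  have := Real.pi_ne_zero
  have h3 : |u.im| ≠ 0 := abs_ne_zero.2 hu
  have h4 : Complex.normSq ((w : ℂ) - u) = (w - u.re) ^ 2 + u.im ^ 2 := by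
    rw [Complex.normSq_apply]; simp; ring
  have h5 : (w - u.re) ^ 2 + u.im ^ 2 ≠ 0 := by positivity
  simp only [cauchyPDFReal_def, norm_inv, inv_pow, Complex.sq_norm, h4, coe_nnnorm,
    Real.norm_eq_abs, sq_abs]
  field_simp

theorem integrable_inv_mul_inv {u v : ℂ} (hu : u.im ≠ 0) (hv : v.im ≠ 0) :
    Integrable fun w : ℝ => ((w : ℂ) - u)⁻¹ * ((w : ℂ) - v)⁻¹ := by
  refine ((integrable_norm_inv_sq hu).add (integrable_norm_inv_sq hv)).mono'
    (Measurable.aestronglyMeasurable (by fun_prop)) (.of_forall fun w => ?_)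
  rw [norm_mul]
  simp only [Pi.add_apply]
  nlinarith [sq_nonneg (‖((w : ℂ) - u)⁻¹‖ - ‖((w : ℂ) - v)⁻¹‖),
    sq_nonneg (‖((w : ℂ) - u)⁻¹‖ + ‖((w : ℂ) - v)⁻¹‖)]

/-- Partial fractions give the antiderivative (log(w - u) - log(w - v)) / (u - v). It is smooth
because w - u and w - v have constant nonzero imaginary part. The divergent log |w| cancels, so only
the branch values at -∞ contribute. -/
theorem integral_inv_mul_inv {u v : ℂ} (hu : u.im ≠ 0) (hv : v.im ≠ 0) (huv : u ≠ v) {l m : ℂ}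
    (hl : Tendsto (fun w : ℝ => Complex.log (-w - u) - Real.log w) atTop (𝓝 l))
    (hm : Tendsto (fun w : ℝ => Complex.log (-w - v) - Real.log w) atTop (𝓝 m)) :
    ∫ w : ℝ, ((w : ℂ) - u)⁻¹ * ((w : ℂ) - v)⁻¹ = (m - l) / (u - v) := by
  have huv' := sub_ne_zero.2 huv
  have hd : ∀ w : ℝ, HasDerivAt
      (fun w : ℝ => (u - v)⁻¹ * (Complex.log (w - u) - Complex.log (w - v)))
      (((w : ℂ) - u)⁻¹ * ((w : ℂ) - v)⁻¹) w := fun w => by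
    refine (((hasDerivAt_log_ofReal_sub hu w).sub (hasDerivAt_log_ofReal_sub hv w)).const_mul
      _).congr_deriv ?_
    have h1 := ofReal_sub_ne_zero_of_im_ne_zero hu w
    have h2 := ofReal_sub_ne_zero_of_im_ne_zero hv w
    field_simp
    ring
  have htop := ((tendsto_log_ofReal_sub_atTop u).sub (tendsto_log_ofReal_sub_atTop v)).const_mul
    (u - v)⁻¹
  have hbot := ((hl.sub hm).const_mul (u - v)⁻¹).comp tendsto_neg_atBot_atTop
  simp only [sub_sub_sub_cancel_right] at htop hbot
  rw [integral_of_hasDerivAt_of_tendsto hd (integrable_inv_mul_inv hu hv)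
    (hbot.congr fun w => by simp) htop]
  field_simp
  ring

theorem integral_inv_mul_inv_of_im_pos {u v : ℂ} (hu : 0 < u.im) (hv : 0 < v.im) :
    ∫ w : ℝ, ((w : ℂ) - u)⁻¹ * ((w : ℂ) - v)⁻¹ = 0 := by
  rcases eq_or_ne u v with rfl | h
  -- The double pole has no logarithmic part; its antiderivative vanishes at both ends.
  · have hd : ∀ w : ℝ, HasDerivAt (fun w : ℝ => -((w : ℂ) - u)⁻¹)
        (((w : ℂ) - u)⁻¹ * ((w : ℂ) - u)⁻¹) w := fun w => by
      have h1 : HasDerivAt (fun w : ℝ => (w : ℂ) - u) 1 w :=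
        ((hasDerivAt_id w).ofReal_comp).sub_const u
      have h0 := ofReal_sub_ne_zero hu w
      refine (h1.inv h0).neg.congr_deriv ?_
      field_simp
    have hz : ∀ l : Filter ℝ, Tendsto (fun w : ℝ => |w|) l atTop →
        Tendsto (fun w : ℝ => -((w : ℂ) - u)⁻¹) l (𝓝 0) := fun l hl => by
      rw [← neg_zero]
      refine Tendsto.neg (tendsto_inv₀_cobounded.comp (tendsto_norm_atTop_iff_cobounded.1 ?_))
      refine tendsto_atTop_mono (fun w => ?_) (tendsto_atTop_add_const_right _ (-‖u‖) hl)
      have := norm_sub_norm_le (w : ℂ) u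
      rw [Complex.norm_real, Real.norm_eq_abs] at this
      linarith
    rw [integral_of_hasDerivAt_of_tendsto hd (integrable_inv_mul_inv hu.ne' hu.ne')
      (hz _ tendsto_abs_atBot_atTop) (hz _ tendsto_abs_atTop_atTop), sub_zero]
  · rw [integral_inv_mul_inv hu.ne' hv.ne' h (tendsto_log_neg_ofReal_sub_of_im_pos hu)
      (tendsto_log_neg_ofReal_sub_of_im_pos hv)]
    simp

theorem stieltjesTransform_cauchyMeasure (a : ℝ) (b : ℝ≥0) {z : ℂ} (hz : 0 < z.im) :
    stieltjesTransform (cauchyMeasure a b) z = (a - b * Complex.I - z)⁻¹ := by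
  rcases eq_or_ne b 0 with rfl | hb
  · simp [stieltjesTransform]
  have hb0 : (0 : ℝ) < b := NNReal.coe_pos.2 (pos_iff_ne_zero.2 hb)
  set p : ℂ := a - b * Complex.I with hp
  set q : ℂ := a + b * Complex.I with hq
  have hpi : p.im < 0 := by simpa [hp] using hb0
  have hqi : 0 < q.im := by simpa [hq] using hb0
  have hzp : z ≠ p := fun h => by rw [h] at hz; linarith
  -- Partial fractions of the density at its poles q = a + bi and p = a - bi. The q term integrates
  -- to 0, having both poles above the axis; the p term gives the transform.
  have key : ∀ w : ℝ, (cauchyPDF a b w).toReal • (1 / ((w : ℂ) - z)) =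
      (2 * Real.pi * Complex.I)⁻¹ * (((w : ℂ) - z)⁻¹ * ((w : ℂ) - q)⁻¹) -
      (2 * Real.pi * Complex.I)⁻¹ * (((w : ℂ) - z)⁻¹ * ((w : ℂ) - p)⁻¹) := fun w => by
    have h0 := ofReal_sub_ne_zero hz w
    have h1 := ofReal_sub_ne_zero hqi w
    have h2 := ofReal_sub_ne_zero_of_im_ne_zero hpi.ne w
    have h3 : (((w - a) ^ 2 + b ^ 2 : ℝ) : ℂ) = ((w : ℂ) - q) * ((w : ℂ) - p) := by
      rw [hp, hq]; push_cast; ring_nf; rw [Complex.I_sq]; ring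
    have h4 : (Real.pi : ℂ) ≠ 0 := by exact_mod_cast Real.pi_ne_zero
    have h5 := Complex.I_ne_zero
    have h6 : q - p = 2 * b * Complex.I := by rw [hp, hq]; ring
    rw [cauchyPDF_def, ENNReal.toReal_ofReal (cauchyPDF_pos a hb w).le, cauchyPDFReal_def,
      Complex.real_smul, Complex.ofReal_mul, Complex.ofReal_inv, h3]
    have h7 : (w : ℂ) - p - (w - q) = 2 * b * Complex.I := by rw [← h6]; ring
    have h8 : (((w : ℂ) - z)⁻¹ * ((w : ℂ) - q)⁻¹) - (((w : ℂ) - z)⁻¹ * ((w : ℂ) - p)⁻¹) =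
       (2 * b * Complex.I) / (((w : ℂ) - z) * ((w : ℂ) - q) * ((w : ℂ) - p)) := by
      rw [← h7]; field_simp
    rw [← mul_sub, h8]
    push_cast
    field_simp
  have hi1 := (integrable_inv_mul_inv hz.ne' hqi.ne').const_mul (2 * Real.pi * Complex.I)⁻¹
  have hi2 := (integrable_inv_mul_inv hz.ne' hpi.ne).const_mul (2 * Real.pi * Complex.I)⁻¹
  rw [stieltjesTransform, cauchyMeasure_of_scale_ne_zero a hb,
    integral_withDensity_eq_integral_toReal_smul (measurable_cauchyPDF a b)
      (.of_forall fun _ => ENNReal.ofReal_lt_top), integral_congr_ae (.of_forall key),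
    integral_sub hi1 hi2, integral_const_mul, integral_const_mul,
    integral_inv_mul_inv_of_im_pos hz hqi, integral_inv_mul_inv hz.ne' hpi.ne hzp
      (tendsto_log_neg_ofReal_sub_of_im_pos hz) (tendsto_log_neg_ofReal_sub_of_im_neg hpi)]
  have h4 : (Real.pi : ℂ) ≠ 0 := by exact_mod_cast Real.pi_ne_zero
  have h5 := Complex.I_ne_zero
  have h6 := sub_ne_zero.2 hzp
  have h7 := sub_ne_zero.2 hzp.symm
  field_simp
  ring

/-! ### The Riccati equation and its solutions -/

theorem im_stieltjesTransform_pos [IsProbabilityMeasure α] {z : ℂ} (hz : 0 < z.im) :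
    0 < (stieltjesTransform α z).im := by
  have hi := (integrable_inv_pow (α := α) hz 1)
  simp only [pow_one] at hi
  have hpos : ∀ w : ℝ, 0 < (((w : ℂ) - z)⁻¹).im := fun w => by
    rw [Complex.inv_im]
    exact div_pos (by simpa using hz) (Complex.normSq_pos.2 (ofReal_sub_ne_zero hz w))
  have h : (stieltjesTransform α z).im = ∫ w : ℝ, (((w : ℂ) - z)⁻¹).im ∂α := by
    simp_rw [stieltjesTransform, one_div]
    exact (integral_im hi).symm
  rw [h, integral_pos_iff_support_of_nonneg (fun w => (hpos w).le) hi.im]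
  have : (Function.support fun w : ℝ => (((w : ℂ) - z)⁻¹).im) = univ :=
    eq_univ_of_forall fun w => (hpos w).ne'
  rw [this]
  simp

/-- The hypothesis is y' = y^2. As y has positive imaginary part it never vanishes, so 1/y + z is a
constant c. -/
theorem eq_cauchyMeasure_of_stieltjesPow_two [IsProbabilityMeasure α]
    (h : ∀ z : ℂ, 0 < z.im → stieltjesPow α 2 z = stieltjesPow α 1 z ^ 2) :
    ∃ (a : ℝ) (b : ℝ≥0), α = cauchyMeasure a b := by
  have hne : ∀ z : ℂ, 0 < z.im → stieltjesPow α 1 z ≠ 0 := fun z hz h0 => by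
    have := im_stieltjesTransform_pos (α := α) hz
    rw [← stieltjesPow_one, h0] at this
    simp at this
  have hd : ∀ z : ℂ, 0 < z.im → HasDerivAt (fun z => (stieltjesPow α 1 z)⁻¹ + z) 0 z :=
    fun z hz => by
      refine (((hasDerivAt_stieltjesPow hz 1).fun_inv (hne z hz)).add (hasDerivAt_id z)).congr_deriv ?_
      rw [h z hz]
      have := hne z hz
      field_simp
      simp
  obtain ⟨c, hc⟩ := isOpen_setOf_im_pos.exists_is_const_of_deriv_eq_zero
    isPreconnected_upperHalfPlane
    (fun z hz => (hd z hz).differentiableAt.differentiableWithinAt) fun z hz => (hd z hz).deriv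
  have hy : ∀ z : ℂ, 0 < z.im → (stieltjesPow α 1 z)⁻¹ = c - z := fun z hz =>
    eq_sub_of_add_eq (hc z hz)
  -- If c lay in the upper half-plane, 1/y would vanish there, which even with 0⁻¹ = 0 forces y(c) =
  -- 0.
  have hci : c.im ≤ 0 := by
    by_contra! hpos
    have := hy c hpos
    exact hne c hpos (by simpa using this)
  -- Here c = a - bi; b = 0 is allowed and gives the Dirac mass.
  refine ⟨c.re, (-c.im).toNNReal, eq_of_stieltjesTransform_eq fun z hz => ?_⟩
  rw [stieltjesTransform_cauchyMeasure _ _ hz, ← stieltjesPow_one, ← inv_inv (stieltjesPow α 1 z),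
    hy z hz]
  congr 2
  rw [Real.coe_toNNReal _ (by linarith)]
  apply Complex.ext <;> simp

theorem stieltjesPow_eq_pow [IsFiniteMeasure α]
    (h : ∀ z : ℂ, 0 < z.im → stieltjesPow α 2 z = stieltjesPow α 1 z ^ 2) (n : ℕ) {z : ℂ}
    (hz : 0 < z.im) : stieltjesPow α (n + 1) z = stieltjesPow α 1 z ^ (n + 1) := by
  induction n generalizing z with
  | zero => simp
  | succ n ih =>
    have e : stieltjesPow α (n + 1) =ᶠ[𝓝 z] fun z => stieltjesPow α 1 z ^ (n + 1) := by
      filter_upwards [isOpen_setOf_im_pos.mem_nhds hz] with u hu using ih hu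
    have h1 := (hasDerivAt_stieltjesPow (α := α) hz (n + 1)).unique
      (((hasDerivAt_stieltjesPow hz 1).fun_pow (n + 1)).congr_of_eventuallyEq e)
    rw [h z hz] at h1
    have h2 : ((n + 1 : ℕ) : ℂ) ≠ 0 := by exact_mod_cast n.succ_ne_zero
    refine mul_left_cancel₀ h2 (h1.trans ?_)
    simp
    ring

/-- The derivative of S_1^2 - S_2 is 2(S_1 S_2 - S_3) = 0, and both terms vanish at i∞. -/
theorem stieltjesPow_two_of_three [IsProbabilityMeasure α]
    (h : ∀ z : ℂ, 0 < z.im → stieltjesPow α 1 z * stieltjesPow α 2 z = stieltjesPow α 3 z) {z : ℂ}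
    (hz : 0 < z.im) : stieltjesPow α 2 z = stieltjesPow α 1 z ^ 2 := by
  have hd : ∀ z : ℂ, 0 < z.im →
      HasDerivAt (fun z => stieltjesPow α 1 z ^ 2 - stieltjesPow α 2 z) 0 z := fun z hz => by
    refine (((hasDerivAt_stieltjesPow hz 1).fun_pow 2).sub
      (hasDerivAt_stieltjesPow hz 2)).congr_deriv ?_
    rw [← h z hz]
    simp
    ring
  obtain ⟨c, hc⟩ := isOpen_setOf_im_pos.exists_is_const_of_deriv_eq_zero
    isPreconnected_upperHalfPlane
    (fun z hz => (hd z hz).differentiableAt.differentiableWithinAt) fun z hz => (hd z hz).deriv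
  have h1 := ((tendsto_stieltjesPow_zero (α := α) 0).pow 2).sub
    (tendsto_stieltjesPow_zero (α := α) 1)
  have h2 := h1.congr' (f₂ := fun _ => c) (by
    filter_upwards [eventually_gt_atTop 0] with s hs
    exact hc _ (by simpa using hs))
  have : c = 0 := by simpa using tendsto_nhds_unique tendsto_const_nhds h2
  have := hc z hz
  simp_all [sub_eq_zero]

theorem stieltjesPow_two_cauchyMeasure (a : ℝ) (b : ℝ≥0) {z : ℂ} (hz : 0 < z.im) :
    stieltjesPow (cauchyMeasure a b) 2 z = stieltjesPow (cauchyMeasure a b) 1 z ^ 2 := by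
  have e : stieltjesPow (cauchyMeasure a b) 1 =ᶠ[𝓝 z] fun z => (a - b * Complex.I - z)⁻¹ := by
    filter_upwards [isOpen_setOf_im_pos.mem_nhds hz] with u hu
    rw [stieltjesPow_one, stieltjesTransform_cauchyMeasure a b hu]
  have h0 : a - b * Complex.I - z ≠ 0 := fun h => by
    have := congrArg Complex.im h
    simp at this
    linarith [b.coe_nonneg]
  have h1 := (hasDerivAt_stieltjesPow (α := cauchyMeasure a b) hz 1).unique
    ((((hasDerivAt_id z).const_sub _).fun_inv h0).congr_of_eventuallyEq e)
  rw [e.eq_of_nhds]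
  simpa using h1

end Stieltjes

/-! ### Independent sequences: prepending a term, growth bounds -/

section Sequences

variable {X : Type*}

/-- Prepend a term to a sequence. -/
def consSeq (p : X × (ℕ → X)) (n : ℕ) : X :=
  Nat.casesOn n p.1 p.2

@[simp] theorem consSeq_zero (p : X × (ℕ → X)) : consSeq p 0 = p.1 := rfl

@[simp] theorem consSeq_succ (p : X × (ℕ → X)) (n : ℕ) : consSeq p (n + 1) = p.2 n := rfl

variable [MeasurableSpace X]

theorem measurable_consSeq : Measurable (consSeq : X × (ℕ → X) → ℕ → X) := by
  refine measurable_pi_iff.2 fun n => ?_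
  cases n with
  | zero => exact measurable_fst
  | succ n => exact (measurable_pi_apply n).comp measurable_snd

/-- Prepending an independent copy preserves the product law; this is the source of the
self-similarity of the Dirichlet mean. It is checked on cylinders, padded by `univ` to an initial
segment so that the first coordinate splits off. -/
theorem map_consSeq (ν : Measure X) [IsProbabilityMeasure ν] :
    (ν.prod (Measure.infinitePi fun _ : ℕ => ν)).map consSeq = Measure.infinitePi fun _ => ν := by
  classical
  refine Measure.eq_infinitePi _ fun s t ht => ?_
  obtain ⟨N, hN⟩ := s.exists_nat_subset_range
  have hN' : s ⊆ Finset.range (N + 1) := hN.trans (Finset.range_mono N.le_succ)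
  set t' : ℕ → Set X := fun i => if i ∈ s then t i else univ with ht'
  have hm : ∀ i, MeasurableSet (t' i) := fun i => by
    simp only [ht']; split_ifs; exacts [ht i, .univ]
  have e1 : ∏ i ∈ s, ν (t i) = ∏ i ∈ Finset.range (N + 1), ν (t' i) := by
    rw [← Finset.prod_subset hN' fun i _ hi => by simp [ht', hi]]
    exact Finset.prod_congr rfl fun i hi => by simp [ht', hi]
  have e2 : consSeq ⁻¹' (Set.pi s t) = t' 0 ×ˢ Set.pi (Finset.range N) fun i => t' (i + 1) := by
    ext p
    simp only [mem_preimage, Set.mem_pi, Finset.mem_coe, Finset.mem_range, mem_prod, ht']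
    constructor
    · refine fun h => ⟨?_, fun i _ => ?_⟩
      · split_ifs with h0
        exacts [h 0 h0, mem_univ _]
      · split_ifs with h0
        exacts [h (i + 1) h0, mem_univ _]
    · rintro ⟨h0, h1⟩ i hi
      rcases i with _ | i
      · simpa [hi] using h0
      · have := h1 i (by have := Finset.mem_range.1 (hN' hi); omega)
        simpa [hi] using this
  rw [Measure.map_apply measurable_consSeq (.pi s.countable_toSet fun _ _ => ht _), e2,
    Measure.prod_prod, Measure.infinitePi_pi _ fun i _ => hm (i + 1), e1, Finset.prod_range_succ',
    mul_comm]

theorem lintegral_infinitePi_prod_range (ν : Measure X) [IsProbabilityMeasure ν] {d : X → ENNReal}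
    (hd : Measurable d) (n : ℕ) :
    ∫⁻ ω, ∏ j ∈ Finset.range n, d (ω j) ∂(Measure.infinitePi fun _ : ℕ => ν) =
      (∫⁻ x, d x ∂ν) ^ n := by
  induction n with
  | zero => simp
  | succ n ih =>
    have hm : ∀ n, Measurable fun ω : ℕ → X => ∏ j ∈ Finset.range n, d (ω j) := fun n => by fun_prop
    rw [← map_consSeq, lintegral_map (hm _) measurable_consSeq]
    simp_rw [Finset.prod_range_succ', consSeq_zero, consSeq_succ]
    have := lintegral_prod_mul (μ := ν) (ν := Measure.infinitePi fun _ : ℕ => ν)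
      hd.aemeasurable (hm n).aemeasurable
    simp_rw [mul_comm _ (d _)]
    rw [this, ih, pow_succ']

theorem measure_infinitePi_eval (ν : Measure X) [IsProbabilityMeasure ν] (n : ℕ) {s : Set X}
    (hs : MeasurableSet s) :
    (Measure.infinitePi fun _ : ℕ => ν) {ω | ω n ∈ s} = ν s :=
  (measurePreserving_eval_infinitePi (fun _ : ℕ => ν) n).measure_preimage hs.nullMeasurableSet

theorem ae_infinitePi_forall {ν : Measure X} [IsProbabilityMeasure ν] {p : X → Prop}
    (hp : ∀ᵐ x ∂ν, p x) : ∀ᵐ ω ∂(Measure.infinitePi fun _ : ℕ => ν), ∀ n, p (ω n) :=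
  ae_all_iff.2 fun n =>
    (measurePreserving_eval_infinitePi (fun _ : ℕ => ν) n).quasiMeasurePreserving.ae hp

/-- Independent copies of a variable with finite mean grow at most linearly, almost surely. -/
theorem ae_eventually_le_of_integrable {ν : Measure X} [IsProbabilityMeasure ν] {f : X → ℝ}
    (hf : Integrable f ν) (hm : Measurable f) (h0 : 0 ≤ f) :
    ∀ᵐ ω ∂(Measure.infinitePi fun _ : ℕ => ν), ∀ᶠ n : ℕ in atTop, f (ω n) ≤ n := by
  let : MeasureSpace X := ⟨ν⟩
  have : IsProbabilityMeasure (ℙ : Measure X) := inferInstanceAs (IsProbabilityMeasure ν)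
  -- A finite mean makes the tail probabilities P(f > n) summable, so Borel–Cantelli applies.
  have h := tsum_prob_mem_Ioi_lt_top (Ω := X) (X := f) hf h0
  have h2 : ∑' n : ℕ, (Measure.infinitePi fun _ : ℕ => ν) {ω | ω n ∈ f ⁻¹' Ioi (n : ℝ)} ≠ ⊤ := by
    simp_rw [fun n : ℕ => measure_infinitePi_eval ν n (hm (measurableSet_Ioi (a := (n : ℝ))))]
    exact h.ne
  filter_upwards [ae_eventually_notMem h2] with ω hω
  filter_upwards [hω] with n hn
  simpa using hn

/-- By independence the series of r^(-n) times the products has expectation ∑ (m/r)^n < ∞, m being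
the mean of d. It therefore converges almost surely, and its terms are eventually at most 1. -/
theorem ae_eventually_prod_le {ν : Measure X} [IsProbabilityMeasure ν] {d : X → ENNReal}
    (hd : Measurable d) {r : ENNReal} (hr : ∫⁻ x, d x ∂ν < r) (hr' : r ≠ ⊤) :
    ∀ᵐ ω ∂(Measure.infinitePi fun _ : ℕ => ν), ∀ᶠ n : ℕ in atTop,
      ∏ j ∈ Finset.range n, d (ω j) ≤ r ^ n := by
  have hr0 : r ≠ 0 := (bot_le.trans_lt hr).ne'
  set m := ∫⁻ x, d x ∂ν with hm
  have hmeas : ∀ n, Measurable fun ω : ℕ → X => ∏ j ∈ Finset.range n, d (ω j) := fun n => by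
    fun_prop
  have h1 : ∫⁻ ω, ∑' n, r⁻¹ ^ n * ∏ j ∈ Finset.range n, d (ω j)
      ∂(Measure.infinitePi fun _ : ℕ => ν) ≠ ⊤ := by
    rw [lintegral_tsum fun n => ((hmeas n).const_mul _).aemeasurable]
    simp_rw [fun n => lintegral_const_mul (μ := Measure.infinitePi fun _ : ℕ => ν) (r⁻¹ ^ n)
      (hmeas n), lintegral_infinitePi_prod_range ν hd, ← mul_pow]
    rw [ENNReal.tsum_geometric]
    refine ENNReal.inv_ne_top.2 (tsub_pos_of_lt ?_).ne'
    rw [mul_comm, ← div_eq_mul_inv]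
    exact (ENNReal.div_lt_iff (.inl hr0) (.inl hr')).2 (by simpa using hr)
  have h2 := ae_lt_top (Measurable.tsum fun n => (hmeas n).const_mul (r⁻¹ ^ n)) h1
  filter_upwards [h2] with ω hω
  filter_upwards [(ENNReal.tendsto_atTop_zero_of_tsum_ne_top hω.ne).eventually_le_const
    zero_lt_one] with n hn
  calc ∏ j ∈ Finset.range n, d (ω j)
      = r ^ n * (r⁻¹ ^ n * ∏ j ∈ Finset.range n, d (ω j)) := by
        rw [← mul_assoc, ← mul_pow, ENNReal.mul_inv_cancel hr0 hr', one_pow, one_mul]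
    _ ≤ r ^ n := mul_le_of_le_one_right' hn

end Sequences

/-! ### The stick-breaking series and the law of its sum -/

theorem ae_betaMeasure_mem_Ioo (s t : ℝ) : ∀ᵐ y ∂betaMeasure s t, y ∈ Ioo (0 : ℝ) 1 := by
  have hm : Measurable (betaPDF s t) := (measurable_betaPDFReal s t).ennreal_ofReal
  rw [betaMeasure, ae_withDensity_iff hm]
  refine .of_forall fun y hy => ⟨?_, ?_⟩
  · by_contra! h
    exact hy (betaPDF_eq_zero_of_nonpos h)
  · by_contra! h
    exact hy (betaPDF_eq_zero_of_one_le h)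

theorem stickBreakingWeight_zero (Y : ℕ → ℝ) : stickBreakingWeight Y 0 = Y 0 := by
  simp [stickBreakingWeight]

theorem stickBreakingWeight_succ (Y : ℕ → ℝ) (n : ℕ) :
    stickBreakingWeight Y (n + 1) = (1 - Y 0) * stickBreakingWeight (fun k => Y (k + 1)) n := by
  simp only [stickBreakingWeight, Finset.prod_range_succ']
  ring

theorem stickBreakingMean_consSeq {E : Type*} [NormedAddCommGroup E] [NormedSpace ℝ E]
    (p : (ℝ × E) × (ℕ → ℝ × E))
    (hs : Summable fun n => stickBreakingWeight (fun k => (p.2 k).1) n • (p.2 n).2) :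
    stickBreakingMean (consSeq p) = p.1.1 • p.1.2 + (1 - p.1.1) • stickBreakingMean p.2 := by
  have e : ∀ n, stickBreakingWeight (fun k => (consSeq p k).1) (n + 1) • (consSeq p (n + 1)).2 =
      (1 - p.1.1) • (stickBreakingWeight (fun k => (p.2 k).1) n • (p.2 n).2) := fun n => by
    rw [stickBreakingWeight_succ, mul_smul]
    rfl
  have hs' : Summable fun n =>
      stickBreakingWeight (fun k => (consSeq p k).1) n • (consSeq p n).2 :=
    (summable_nat_add_iff 1).1 (by simpa only [e] using hs.const_smul (1 - p.1.1))
  rw [stickBreakingMean, hs'.tsum_eq_zero_add, stickBreakingWeight_zero]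
  simp_rw [e]
  rw [hs.tsum_const_smul]
  rfl

/-- Take logarithms in 1 + ‖Lx‖ ≤ (1 + ‖L‖)(1 + ‖x‖). -/
theorem MemFT.map {E F : Type*} [NormedAddCommGroup E] [NormedSpace ℝ E] [MeasurableSpace E]
    [BorelSpace E] [NormedAddCommGroup F] [NormedSpace ℝ F] [MeasurableSpace F] [BorelSpace F]
    {α : Measure E} [IsProbabilityMeasure α] (hα : MemFT α) (L : E →L[ℝ] F) : MemFT (α.map L) := by
  have hL : Measurable L := L.continuous.measurable
  rw [MemFT, integrable_map_measure (Measurable.aestronglyMeasurable (by fun_prop)) hL.aemeasurable]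
  refine ((integrable_const (Real.log (1 + ‖L‖))).add hα).mono'
    (Measurable.aestronglyMeasurable (by fun_prop)) (.of_forall fun x => ?_)
  simp only [Function.comp_apply, Pi.add_apply]
  rw [Real.norm_of_nonneg (Real.log_nonneg (by simp)), ← Real.log_mul (by positivity) (by positivity)]
  refine Real.log_le_log (by positivity) ?_
  have := L.le_opNorm x
  nlinarith [norm_nonneg L, norm_nonneg x]

section Law

variable {E : Type*} [NormedAddCommGroup E] [NormedSpace ℝ E] [CompleteSpace E]
  [MeasurableSpace E] [BorelSpace E] [SecondCountableTopology E] {α : Measure E}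
  [IsProbabilityMeasure α] {t : ℝ}

/-- The law of the sequence `(Y n, B n)` governing the stick breaking. -/
noncomputable abbrev stickBreakingLaw (t : ℝ) (α : Measure E) : Measure (ℕ → ℝ × E) :=
  Measure.infinitePi fun _ : ℕ => (betaMeasure 1 t).prod α

/-- The products of 1 - Y_j decay at least like r^n for some r < 1, while the logarithmic moment
keeps ‖B_n‖ below any prescribed geometric growth. -/
theorem ae_summable_stickBreaking (ht : 0 < t) (hα : MemFT α) :
    ∀ᵐ ω ∂stickBreakingLaw t α,
      Summable fun n => stickBreakingWeight (fun k => (ω k).1) n • (ω n).2 := by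
  have := isProbabilityMeasureBeta one_pos ht
  set ν := (betaMeasure 1 t).prod α
  have hY : ∀ᵐ x ∂ν, x.1 ∈ Ioo (0 : ℝ) 1 :=
    Measure.quasiMeasurePreserving_fst.ae (ae_betaMeasure_mem_Ioo 1 t)
  have hd : Measurable fun x : ℝ × E => ENNReal.ofReal (1 - x.1) := by fun_prop
  have hm : ∫⁻ x, ENNReal.ofReal (1 - x.1) ∂ν < 1 := by
    have hlt : ∀ᵐ x ∂ν, ENNReal.ofReal (1 - x.1) < 1 := by
      filter_upwards [hY] with x hx
      rw [ENNReal.ofReal_lt_one]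
      linarith [hx.1]
    have hle : ∫⁻ x, ENNReal.ofReal (1 - x.1) ∂ν ≠ ⊤ := by
      refine ne_top_of_le_ne_top ENNReal.one_ne_top
        ((lintegral_mono_ae (hlt.mono fun x hx => hx.le)).trans ?_)
      simp
    simpa using lintegral_strict_mono (IsProbabilityMeasure.ne_zero ν) aemeasurable_const hle hlt
  obtain ⟨r, hr1, hr2⟩ := ENNReal.lt_iff_exists_nnreal_btwn.1 hm
  have hr0 : (0 : ℝ) < r := NNReal.coe_pos.2 (ENNReal.coe_pos.1 (bot_le.trans_lt hr1))
  have hr2' : (r : ℝ) < 1 := by exact_mod_cast hr2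
  -- With r = q^2, one factor q^n absorbs ‖B_n‖ and the other is summable.
  set q : ℝ := Real.sqrt r with hq
  have hq0 : 0 < q := Real.sqrt_pos.2 hr0
  have hq1 : q < 1 := by rw [hq, Real.sqrt_lt' one_pos]; simpa using hr2'
  have hqr : (r : ℝ) = q * q := (Real.mul_self_sqrt hr0.le).symm
  have hε : 0 < -Real.log q := neg_pos.2 (Real.log_neg hq0 hq1)
  have hlog : ∀ᵐ ω ∂stickBreakingLaw t α,
      ∀ᶠ n : ℕ in atTop, Real.log (1 + ‖(ω n).2‖) / (-Real.log q) ≤ n := by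
    refine ae_eventually_le_of_integrable (ν := ν)
      (f := fun x => Real.log (1 + ‖x.2‖) / (-Real.log q)) ?_ ?_ fun x => ?_
    · exact Integrable.div_const (Integrable.comp_snd hα _) _
    · fun_prop
    · exact div_nonneg (Real.log_nonneg (by simp)) hε.le
  filter_upwards [ae_infinitePi_forall hY, ae_eventually_prod_le hd hr1 ENNReal.coe_ne_top, hlog]
    with ω h1 h2 h3
  refine Summable.of_norm_bounded_eventually_nat (summable_geometric_of_lt_one hq0.le hq1) ?_
  filter_upwards [h2, h3] with n h2n h3n
  have hprod : ∏ j ∈ Finset.range n, (1 - (ω j).1) ≤ (r : ℝ) ^ n := by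
    rw [← ENNReal.ofReal_prod_of_nonneg fun j _ => by linarith [(h1 j).2]] at h2n
    have : (r : ENNReal) ^ n = ENNReal.ofReal ((r : ℝ) ^ n) := by
      rw [ENNReal.ofReal_pow hr0.le, ENNReal.ofReal_coe_nnreal]
    rw [this] at h2n
    exact (ENNReal.ofReal_le_ofReal_iff (by positivity)).1 h2n
  have hpos : 0 ≤ ∏ j ∈ Finset.range n, (1 - (ω j).1) :=
    Finset.prod_nonneg fun j _ => by linarith [(h1 j).2]
  have hB : q ^ n * ‖(ω n).2‖ ≤ 1 := by
    rw [div_le_iff₀ hε] at h3n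
    have h4 : Real.log (q ^ n * (1 + ‖(ω n).2‖)) ≤ 0 := by
      rw [Real.log_mul (by positivity) (by positivity), Real.log_pow]
      linarith
    have h5 : q ^ n * (1 + ‖(ω n).2‖) ≤ 1 := by
      by_contra! h
      exact absurd (Real.log_pos h) (not_lt.2 h4)
    have : 0 < q ^ n := by positivity
    linarith
  rw [norm_smul, stickBreakingWeight, norm_mul, Real.norm_of_nonneg hpos,
    Real.norm_of_nonneg (h1 n).1.le]
  calc (ω n).1 * (∏ j ∈ Finset.range n, (1 - (ω j).1)) * ‖(ω n).2‖
      ≤ 1 * (r : ℝ) ^ n * ‖(ω n).2‖ := by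
        gcongr
        exact (h1 n).2.le
    _ = q ^ n * (q ^ n * ‖(ω n).2‖) := by rw [hqr, mul_pow]; ring
    _ ≤ q ^ n := mul_le_of_le_one_right (by positivity) hB

/-- Needed for the law to be a probability: `Measure.map` is 0 on functions that are not a.e.
measurable. -/
theorem aemeasurable_stickBreakingMean (ht : 0 < t) (hα : MemFT α) :
    AEMeasurable (stickBreakingMean (E := E)) (stickBreakingLaw t α) := by
  refine aemeasurable_of_tendsto_metrizable_ae atTop
    (f := fun (n : ℕ) (ω : ℕ → ℝ × E) => ∑ k ∈ Finset.range n,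
      stickBreakingWeight (fun k => (ω k).1) k • (ω k).2) (fun n => ?_) ?_
  · unfold stickBreakingWeight
    exact Measurable.aemeasurable (by fun_prop)
  · filter_upwards [ae_summable_stickBreaking ht hα] with ω hω
    exact hω.hasSum.tendsto_sum_nat

theorem isProbabilityMeasure_dirichletMeanLaw (ht : 0 < t) (hα : MemFT α) :
    IsProbabilityMeasure (dirichletMeanLaw t α) := by
  have := isProbabilityMeasureBeta one_pos ht
  exact Measure.isProbabilityMeasure_map (aemeasurable_stickBreakingMean ht hα)

/-- The law `μ` of the Dirichlet mean is the law of `Y • B + (1 - Y) • X`, where `Y ∼ β(1,t)`,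
`B ∼ α` and `X ∼ μ` are independent. -/
theorem dirichletMeanLaw_eq_map (ht : 0 < t) (hα : MemFT α) :
    dirichletMeanLaw t α = (((betaMeasure 1 t).prod α).prod (dirichletMeanLaw t α)).map
      fun p => p.1.1 • p.1.2 + (1 - p.1.1) • p.2 := by
  have := isProbabilityMeasureBeta one_pos ht
  have := isProbabilityMeasure_dirichletMeanLaw ht hα
  set ν := (betaMeasure 1 t).prod α with hν
  have hae := aemeasurable_stickBreakingMean ht hα
  have hmk := hae.measurable_mk
  have e1 : dirichletMeanLaw t α = (stickBreakingLaw t α).map (hae.mk _) :=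
    Measure.map_congr hae.ae_eq_mk
  have hφ : Measurable fun p : (ℝ × E) × E => p.1.1 • p.1.2 + (1 - p.1.1) • p.2 := by fun_prop
  have hcons := map_consSeq ν
  have hae' : AEMeasurable (stickBreakingMean (E := E))
      ((ν.prod (stickBreakingLaw t α)).map consSeq) := by rw [hcons]; exact hae
  have e2 : ν.prod (dirichletMeanLaw t α) =
      (ν.prod (stickBreakingLaw t α)).map (Prod.map id (hae.mk _)) := by
    rw [← Measure.map_prod_map _ _ measurable_id hmk, Measure.map_id, e1]
  rw [e2, Measure.map_map hφ (measurable_id.prodMap hmk)]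
  -- Write the sequence as a first term followed by an independent copy, so that the recursion for
  -- the sum applies almost surely.
  conv_lhs => rw [dirichletMeanLaw, ← hν, ← hcons]
  rw [AEMeasurable.map_map_of_aemeasurable hae' measurable_consSeq.aemeasurable]
  refine Measure.map_congr ?_
  filter_upwards [Measure.quasiMeasurePreserving_snd.ae hae.ae_eq_mk,
    Measure.quasiMeasurePreserving_snd.ae (ae_summable_stickBreaking ht hα)] with p hp hs
  exact (stickBreakingMean_consSeq p hs).trans (by rw [hp]; rfl)

variable {F : Type*} [NormedAddCommGroup F] [NormedSpace ℝ F] [CompleteSpace F]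
  [MeasurableSpace F] [BorelSpace F] [SecondCountableTopology F]

/-- Dirichlet means commute with continuous linear maps. -/
theorem map_dirichletMeanLaw (ht : 0 < t) (hα : MemFT α) (L : E →L[ℝ] F) :
    (dirichletMeanLaw t α).map L = dirichletMeanLaw t (α.map L) := by
  have := isProbabilityMeasureBeta one_pos ht
  have hL : Measurable L := L.continuous.measurable
  have := Measure.isProbabilityMeasure_map (μ := α) hL.aemeasurable
  have hae := aemeasurable_stickBreakingMean ht hα
  have hae' := aemeasurable_stickBreakingMean ht (hα.map L)
  have e : stickBreakingLaw t (α.map L) =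
      (stickBreakingLaw t α).map fun ω n => Prod.map id L (ω n) := by
    rw [stickBreakingLaw, stickBreakingLaw, Measure.infinitePi_map_pi (X := fun _ => ℝ × E)
      (Y := fun _ => ℝ × F) _ fun _ => measurable_id.prodMap hL]
    congr with i : 1
    rw [← Measure.map_prod_map _ _ measurable_id hL, Measure.map_id]
  rw [dirichletMeanLaw, AEMeasurable.map_map_of_aemeasurable hL.aemeasurable hae, dirichletMeanLaw]
  change _ = Measure.map _ (stickBreakingLaw t (α.map L))
  rw [e] at hae' ⊢
  rw [AEMeasurable.map_map_of_aemeasurable hae' (Measurable.aemeasurable (by fun_prop))]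
  refine Measure.map_congr ?_
  filter_upwards [ae_summable_stickBreaking ht hα] with ω hω
  simp only [Function.comp_apply, stickBreakingMean, L.map_tsum hω, map_smul, Prod.map_fst,
    Prod.map_snd, id]

end Law

/-! ### The beta integral linearising the resolvent -/

theorem toReal_betaPDF_one (n : ℕ) (y : ℝ) :
    (betaPDF 1 (n + 1 : ℕ) y).toReal =
      (Ioo (0 : ℝ) 1).indicator (fun y => (n + 1 : ℝ) * (1 - y) ^ n) y := by
  by_cases h : 0 < y ∧ y < 1
  · have hn : Real.Gamma (n + 1 : ℝ) ≠ 0 := (Real.Gamma_pos_of_pos (by positivity)).ne'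
    have hb : 1 / beta 1 (n + 1 : ℕ) = n + 1 := by
      have : (1 : ℝ) + (n + 1) = (n + 1) + 1 := by ring
      rw [beta, Real.Gamma_one, Nat.cast_succ, this, Real.Gamma_add_one (s := (n + 1 : ℝ)) (by positivity)]
      field_simp
    rw [betaPDF_of_pos_lt_one h.1 h.2, indicator_of_mem (show y ∈ Ioo (0 : ℝ) 1 from h), hb]
    have : (((n + 1 : ℕ) : ℝ) - 1) = n := by push_cast; ring
    rw [this, sub_self, Real.rpow_zero, mul_one, Real.rpow_natCast, ENNReal.toReal_ofReal]
    have := sub_pos.2 h.2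
    positivity
  · rw [indicator_of_notMem (show y ∉ Ioo (0 : ℝ) 1 from h), betaPDF_eq, if_neg h]
    simp

theorem integral_betaMeasure_one (n : ℕ) (g : ℝ → ℂ) :
    ∫ y, g y ∂betaMeasure 1 (n + 1 : ℕ) =
      ∫ y in (0 : ℝ)..1, ((n + 1 : ℝ) * (1 - y) ^ n) • g y := by
  have hm : Measurable (betaPDF 1 (n + 1 : ℕ)) := (measurable_betaPDFReal _ _).ennreal_ofReal
  rw [betaMeasure, integral_withDensity_eq_integral_toReal_smul hm
    (.of_forall fun _ => ENNReal.ofReal_lt_top), intervalIntegral.integral_of_le zero_le_one,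
    integral_Ioc_eq_integral_Ioo, ← integral_indicator measurableSet_Ioo]
  congr with y
  rw [toReal_betaPDF_one]
  by_cases h : y ∈ Ioo (0 : ℝ) 1 <;> simp [h]

/-- The two-point Feynman parametrization. -/
theorem integral_betaMeasure_inv_pow (n : ℕ) (b x : ℝ) {z : ℂ} (hz : 0 < z.im) :
    ∫ y, (((y * b + (1 - y) * x : ℝ) : ℂ) - z)⁻¹ ^ (n + 2) ∂betaMeasure 1 (n + 1 : ℕ) =
      ((b : ℂ) - z)⁻¹ * ((x : ℂ) - z)⁻¹ ^ (n + 1) := by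
  have h0 : ∀ y : ℝ, ((y * b + (1 - y) * x : ℝ) : ℂ) - z ≠ 0 := fun y => ofReal_sub_ne_zero hz _
  have hb := ofReal_sub_ne_zero hz b
  -- With D(y) = yb + (1 - y)x - z, the primitive is -((1 - y)/D)^(n+1) / (b - z): zero at y = 1,
  -- and minus the desired value at y = 0. No case split on b = x is needed.
  have hd : ∀ y : ℝ, HasDerivAt (fun y : ℝ => -(((b : ℂ) - z)⁻¹ *
      ((1 - y : ℝ) * (((y * b + (1 - y) * x : ℝ) : ℂ) - z)⁻¹) ^ (n + 1)))
      (((n + 1 : ℝ) * (1 - y) ^ n) • (((y * b + (1 - y) * x : ℝ) : ℂ) - z)⁻¹ ^ (n + 2)) y := by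
    intro y
    have h1 : HasDerivAt (fun y : ℝ => ((1 - y : ℝ) : ℂ)) ((-1 : ℝ) : ℂ) y :=
      ((hasDerivAt_id y).const_sub 1).ofReal_comp
    have h2 : HasDerivAt (fun y : ℝ => ((y * b + (1 - y) * x : ℝ) : ℂ) - z)
        ((1 * b + (-1) * x : ℝ) : ℂ) y :=
      ((((hasDerivAt_id y).mul_const b).add
        (((hasDerivAt_id y).const_sub 1).mul_const x)).ofReal_comp).sub_const z
    refine (((h1.fun_mul (h2.fun_inv (h0 y))).fun_pow (n + 1)).const_mul ((b : ℂ) - z)⁻¹).neg.congr_deriv ?_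
    -- The identity (1 - y)D' = (b - z) - D makes the derivative of (1 - y)/D equal to -(b - z)/D^2.
    have e : ((1 * b + (-1) * x : ℝ) : ℂ) * (1 - y : ℝ) =
        ((b : ℂ) - z) - (((y * b + (1 - y) * x : ℝ) : ℂ) - z) := by push_cast; ring
    have hD := h0 y
    set D := ((y * b + (1 - y) * x : ℝ) : ℂ) - z
    rw [Complex.real_smul]
    have e2 : ((-1 : ℝ) : ℂ) * D⁻¹ + (1 - y : ℝ) * (-((1 * b + (-1) * x : ℝ) : ℂ) / D ^ 2) =
        -((b : ℂ) - z) * D⁻¹ ^ 2 := by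
      have : (1 - y : ℝ) * (-((1 * b + (-1) * x : ℝ) : ℂ) / D ^ 2) =
        -(((1 * b + (-1) * x : ℝ) : ℂ) * (1 - y : ℝ)) / D ^ 2 := by ring
      rw [this, e]
      field_simp
      push_cast
      ring
    rw [e2, Nat.add_sub_cancel]
    push_cast
    rw [mul_pow, pow_add D⁻¹ n 2]
    field_simp
  rw [integral_betaMeasure_one, intervalIntegral.integral_eq_sub_of_hasDerivAt (fun y _ => hd y)]
  · simp
  · refine Continuous.intervalIntegrable ?_ _ _
    have : Continuous fun y : ℝ => (((y * b + (1 - y) * x : ℝ) : ℂ) - z)⁻¹ :=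
      Continuous.inv₀ (by fun_prop) h0
    exact (by fun_prop : Continuous fun y : ℝ => (n + 1 : ℝ) * (1 - y) ^ n).smul (this.pow _)

/-! ### Fixed points on the line and in higher dimension -/

section FixedPoints

variable {α : Measure ℝ} [IsProbabilityMeasure α]

/-- The Cifarelli–Regazzini relation in differential form. -/
theorem stieltjesPow_dirichletMeanLaw (n : ℕ) (hα : MemFT α) {z : ℂ} (hz : 0 < z.im) :
    stieltjesPow (dirichletMeanLaw (n + 1 : ℕ) α) (n + 2) z =
      stieltjesPow α 1 z * stieltjesPow (dirichletMeanLaw (n + 1 : ℕ) α) (n + 1) z := by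
  have ht : (0 : ℝ) < (n + 1 : ℕ) := by positivity
  have := isProbabilityMeasureBeta one_pos ht
  have := isProbabilityMeasure_dirichletMeanLaw ht hα
  set μ := dirichletMeanLaw (n + 1 : ℕ) α with hμ
  have hφ : Measurable fun p : (ℝ × ℝ) × ℝ => p.1.1 • p.1.2 + (1 - p.1.1) • p.2 := by fun_prop
  have hg := measurable_inv_pow z (n + 2)
  have hbd : ∀ w : ℝ, ‖((w : ℂ) - z)⁻¹ ^ (n + 2)‖ ≤ z.im⁻¹ ^ (n + 2) := fun w =>
    norm_inv_pow_le hz le_rfl w _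
  have e1 : stieltjesPow μ (n + 2) z =
      ∫ p : (ℝ × ℝ) × ℝ, (((p.1.1 * p.1.2 + (1 - p.1.1) * p.2 : ℝ) : ℂ) - z)⁻¹ ^ (n + 2)
        ∂((betaMeasure 1 (n + 1 : ℕ)).prod α).prod μ := by
    rw [stieltjesPow]
    conv_lhs => rw [hμ, dirichletMeanLaw_eq_map ht hα]
    rw [integral_map hφ.aemeasurable hg.aestronglyMeasurable]
    rfl
  -- With x fixed, Y is integrated first; this separates the variables b and x.
  have e2 : ∀ x, ∫ p : ℝ × ℝ, (((p.1 * p.2 + (1 - p.1) * x : ℝ) : ℂ) - z)⁻¹ ^ (n + 2)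
      ∂(betaMeasure 1 (n + 1 : ℕ)).prod α = stieltjesPow α 1 z * ((x : ℂ) - z)⁻¹ ^ (n + 1) := by
    intro x
    rw [integral_prod_symm _ (.of_bound (Measurable.aestronglyMeasurable (by fun_prop)) _
      (.of_forall fun _ => hbd _))]
    simp_rw [integral_betaMeasure_inv_pow n _ x hz, integral_mul_const, stieltjesPow, pow_one]
  rw [e1, integral_prod_symm _ (.of_bound (Measurable.aestronglyMeasurable (by fun_prop)) _
      (.of_forall fun _ => hbd _))]
  simp_rw [e2, integral_const_mul]
  rfl

/-- For the converse, S_{n+1} of both laws satisfies F' = (n + 1) y F, so their ratio is constant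
where defined, and the normalisation at i∞ makes it 1. -/
theorem dirichletMeanLaw_eq_iff_stieltjesPow (n : ℕ) (hα : MemFT α) :
    dirichletMeanLaw (n + 1 : ℕ) α = α ↔ ∀ z : ℂ, 0 < z.im →
      stieltjesPow α 1 z * stieltjesPow α (n + 1) z = stieltjesPow α (n + 2) z := by
  have ht : (0 : ℝ) < (n + 1 : ℕ) := by positivity
  have := isProbabilityMeasure_dirichletMeanLaw ht hα
  constructor
  · intro h z hz
    have h1 := stieltjesPow_dirichletMeanLaw n hα hz
    rw [h] at h1
    exact h1.symm
  intro h
  set μ := dirichletMeanLaw (n + 1 : ℕ) α with hμ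
  refine eq_of_stieltjesPow_eq n ?_
  have hI : ∀ s : ℝ, HasDerivAt (fun s : ℝ => (s : ℂ) * Complex.I) Complex.I s := fun s => by
    simpa using (hasDerivAt_id s).ofReal_comp.mul_const Complex.I
  have hF : ∀ s : ℝ, 0 < s → HasDerivAt (fun s : ℝ => stieltjesPow μ (n + 1) (s * Complex.I))
      (((n + 1 : ℕ) * (stieltjesPow α 1 (s * Complex.I) *
        stieltjesPow μ (n + 1) (s * Complex.I))) * Complex.I) s := fun s hs => by
    have hz : 0 < ((s : ℂ) * Complex.I).im := by simpa using hs
    rw [← stieltjesPow_dirichletMeanLaw n hα hz]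
    exact (hasDerivAt_stieltjesPow (α := μ) hz (n + 1)).comp s (hI s)
  have hG : ∀ s : ℝ, 0 < s → HasDerivAt (fun s : ℝ => stieltjesPow α (n + 1) (s * Complex.I))
      (((n + 1 : ℕ) * (stieltjesPow α 1 (s * Complex.I) *
        stieltjesPow α (n + 1) (s * Complex.I))) * Complex.I) s := fun s hs => by
    have hz : 0 < ((s : ℂ) * Complex.I).im := by simpa using hs
    rw [h _ hz]
    exact (hasDerivAt_stieltjesPow (α := α) hz (n + 1)).comp s (hI s)
  have hFlim := tendsto_pow_mul_stieltjesPow (α := μ) (n + 1)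
  have hGlim := tendsto_pow_mul_stieltjesPow (α := α) (n + 1)
  have hone : ((-1 : ℂ)) ^ (n + 1) ≠ 0 := pow_ne_zero _ (by simp)
  -- The denominator is known to be nonzero only far up the imaginary axis, so the ratio is formed
  -- on that ray.
  obtain ⟨s₀, hs₀⟩ := eventually_atTop.1 ((hGlim.eventually_ne hone).and (eventually_gt_atTop 0))
  have hG0 : ∀ s ∈ Ioi s₀, stieltjesPow α (n + 1) (s * Complex.I) ≠ 0 := fun s hs =>
    right_ne_zero_of_mul (hs₀ s (le_of_lt hs)).1
  have hpos : ∀ s ∈ Ioi s₀, 0 < s := fun s hs => (hs₀ s (le_of_lt hs)).2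
  have hd : ∀ s ∈ Ioi s₀, HasDerivAt (fun s : ℝ =>
      stieltjesPow μ (n + 1) (s * Complex.I) / stieltjesPow α (n + 1) (s * Complex.I)) 0 s :=
    fun s hs => by
      refine ((hF s (hpos s hs)).fun_div (hG s (hpos s hs)) (hG0 s hs)).congr_deriv ?_
      rw [div_eq_zero_iff]
      left
      ring
  obtain ⟨c, hc⟩ := isOpen_Ioi.exists_is_const_of_deriv_eq_zero isPreconnected_Ioi
    (fun s hs => (hd s hs).differentiableAt.differentiableWithinAt) fun s hs => (hd s hs).deriv
  have hlim := (hFlim.div hGlim hone).congr' (f₂ := fun _ => c) (by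
    filter_upwards [eventually_gt_atTop s₀] with s hs
    rw [← hc s hs, Pi.div_apply, mul_div_mul_left]
    have := (hpos s hs).ne'
    exact pow_ne_zero _ (mul_ne_zero (by exact_mod_cast this) Complex.I_ne_zero))
  have hc1 : c = 1 := by
    rw [tendsto_nhds_unique tendsto_const_nhds hlim, div_self hone]
  have hray : ∀ s ∈ Ioi s₀,
      stieltjesPow μ (n + 1) (s * Complex.I) = stieltjesPow α (n + 1) (s * Complex.I) :=
    fun s hs => by
      have := hc s hs
      rwa [hc1, div_eq_one_iff_eq (hG0 s hs)] at this
  have hs₁ : s₀ + 1 ∈ Ioi s₀ := by simp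
  have htend : Tendsto (fun s : ℝ => (s : ℂ) * Complex.I) (𝓝[≠] (s₀ + 1))
      (𝓝[≠] ((s₀ + 1 : ℝ) * Complex.I)) := by
    refine tendsto_nhdsWithin_iff.2 ⟨(hI _).continuousAt.tendsto.mono_left nhdsWithin_le_nhds, ?_⟩
    filter_upwards [self_mem_nhdsWithin] with s hs h
    exact hs (Complex.ofReal_injective (mul_right_cancel₀ Complex.I_ne_zero h))
  -- Equality on the ray accumulates at one of its points; the identity theorem extends it to the
  -- half-plane.
  have hfreq : ∃ᶠ z in 𝓝[≠] (((s₀ + 1 : ℝ) : ℂ) * Complex.I),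
      stieltjesPow μ (n + 1) z = stieltjesPow α (n + 1) z := by
    refine htend.frequently (Eventually.frequently ?_)
    filter_upwards [mem_nhdsWithin_of_mem_nhds (isOpen_Ioi.mem_nhds hs₁)] with s hs using hray s hs
  have hz₁ : 0 < (((s₀ + 1 : ℝ) : ℂ) * Complex.I).im := by
    rw [im_ofReal_mul_I]; exact hpos _ hs₁
  exact ((differentiableOn_stieltjesPow (n + 1)).analyticOnNhd
    isOpen_setOf_im_pos).eqOn_of_preconnected_of_frequently_eq
    ((differentiableOn_stieltjesPow (n + 1)).analyticOnNhd isOpen_setOf_im_pos)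
    isPreconnected_upperHalfPlane hz₁ hfreq

theorem stieltjesTransform_ode_iff {z : ℂ} (hz : 0 < z.im) (n : ℕ) :
    ((n + 1 : ℕ) : ℂ) * stieltjesTransform α z * iteratedDeriv n (stieltjesTransform α) z =
        iteratedDeriv (n + 1) (stieltjesTransform α) z ↔
      stieltjesPow α 1 z * stieltjesPow α (n + 1) z = stieltjesPow α (n + 2) z := by
  have h : (((n + 1).factorial : ℕ) : ℂ) ≠ 0 := by exact_mod_cast (n + 1).factorial_ne_zero
  rw [iteratedDeriv_stieltjesTransform n hz, iteratedDeriv_stieltjesTransform (n + 1) hz,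
    stieltjesPow_one, ← mul_right_inj' (c := stieltjesPow α (n + 2) z) h]
  have e : ((n + 1 : ℕ) : ℂ) * stieltjesTransform α z *
      ((n.factorial : ℕ) * stieltjesPow α (n + 1) z) =
      ((n + 1).factorial : ℕ) * (stieltjesTransform α z * stieltjesPow α (n + 1) z) := by
    rw [Nat.factorial_succ]
    push_cast
    ring
  rw [e]

/-- For `n = 1, 2`, the fixed points of `α ↦ μ(nα)` on the line are the Cauchy laws (including the
degenerate ones). -/
theorem dirichletMeanLaw_eq_iff_cauchyMeasure {n : ℕ} (hn : n = 1 ∨ n = 2) (hα : MemFT α) :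
    dirichletMeanLaw n α = α ↔ ∃ (a : ℝ) (b : ℝ≥0), α = cauchyMeasure a b := by
  -- The Riccati equation is the common criterion for both values of n.
  have h1 : (∃ (a : ℝ) (b : ℝ≥0), α = cauchyMeasure a b) ↔
      ∀ z : ℂ, 0 < z.im → stieltjesPow α 2 z = stieltjesPow α 1 z ^ 2 := by
    refine ⟨?_, eq_cauchyMeasure_of_stieltjesPow_two⟩
    rintro ⟨a, b, rfl⟩ z hz
    exact stieltjesPow_two_cauchyMeasure a b hz
  rw [h1]
  rcases hn with rfl | rfl
  · rw [dirichletMeanLaw_eq_iff_stieltjesPow 0 hα]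
    refine forall₂_congr fun z _ => ?_
    rw [eq_comm, sq]
  · rw [dirichletMeanLaw_eq_iff_stieltjesPow 1 hα]
    refine ⟨fun h z hz => stieltjesPow_two_of_three h hz, fun h z hz => ?_⟩
    rw [h z hz, stieltjesPow_eq_pow h 2 hz]
    ring

/-- `cauchyMeasure` with scale 0 is the Dirac mass, so one family covers both cases. -/
theorem isRealCauchy_or_isRealDirac_iff {β : Measure ℝ} :
    IsRealCauchy β ∨ IsRealDirac β ↔ ∃ (a : ℝ) (b : ℝ≥0), β = cauchyMeasure a b := by
  constructor
  · rintro (⟨a, b, -, h⟩ | ⟨a, h⟩)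
    · exact ⟨a, b, h⟩
    · exact ⟨a, 0, by rw [h, cauchyMeasure_zero_scale]⟩
  · rintro ⟨a, b, h⟩
    rcases eq_or_ne b 0 with rfl | hb
    · exact .inr ⟨a, by rw [h, cauchyMeasure_zero_scale]⟩
    · exact .inl ⟨a, b, pos_iff_ne_zero.2 hb, h⟩

theorem dirichletMeanLaw_eq_iff_isCauchy {d n : ℕ} (hn : n = 1 ∨ n = 2)
    {α : Measure (EuclideanSpace ℝ (Fin d))} [IsProbabilityMeasure α] (hα : MemFT α) :
    dirichletMeanLaw n α = α ↔ IsCauchy α := by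
  have ht : (0 : ℝ) < n := by rcases hn with rfl | rfl <;> norm_num
  have := isProbabilityMeasure_dirichletMeanLaw ht hα
  have key : ∀ L : EuclideanSpace ℝ (Fin d) →L[ℝ] ℝ,
      (dirichletMeanLaw n α).map L = α.map L ↔
        IsRealCauchy (α.map L) ∨ IsRealDirac (α.map L) := fun L => by
    have := Measure.isProbabilityMeasure_map (μ := α) L.continuous.aemeasurable
    rw [map_dirichletMeanLaw ht hα, dirichletMeanLaw_eq_iff_cauchyMeasure hn (hα.map L),
      isRealCauchy_or_isRealDirac_iff]
  constructor
  · intro h f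
    exact (key (innerSL ℝ f)).1 (by rw [h])
  · intro h
    -- Cramér–Wold: the characteristic function at L depends only on the image under L, and by Riesz
    -- each L is an inner product with a vector.
    refine Measure.ext_of_charFunDual (funext fun L => ?_)
    have e : (fun x => inner ℝ ((InnerProductSpace.toDual ℝ _).symm L) x) = L :=
      funext fun x => InnerProductSpace.toDual_symm_apply
    have h1 := h ((InnerProductSpace.toDual ℝ _).symm L)
    rw [e] at h1
    rw [charFunDual_eq_charFun_map_one, charFunDual_eq_charFun_map_one, (key L).2 h1]

end FixedPoints

theorem proposition6p1 :
    (∀ (α : Measure ℝ) [IsProbabilityMeasure α], MemFT α →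
      (∀ n : ℕ, 1 ≤ n →
        (dirichletMeanLaw n α = α ↔
          ∀ z : ℂ, 0 < z.im →
            (n : ℂ) * stieltjesTransform α z * iteratedDeriv (n - 1) (stieltjesTransform α) z
              = iteratedDeriv n (stieltjesTransform α) z)) ∧
      (∀ n : ℕ, n = 1 ∨ n = 2 →
        (dirichletMeanLaw n α = α ∨
          ∀ z : ℂ, 0 < z.im →
            (n : ℂ) * stieltjesTransform α z * iteratedDeriv (n - 1) (stieltjesTransform α) z
              = iteratedDeriv n (stieltjesTransform α) z) →
        IsRealCauchy α ∨ IsRealDirac α)) ∧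
    (∀ (d : ℕ) (α : Measure (EuclideanSpace ℝ (Fin d))) [IsProbabilityMeasure α], MemFT α →
      (dirichletMeanLaw 1 α = α ↔ IsCauchy α) ∧
      (dirichletMeanLaw 2 α = α ↔ IsCauchy α)) := by
  refine ⟨fun α _ hα => ?_, fun d α _ hα => ⟨?_, ?_⟩⟩
  · have hiff : ∀ n : ℕ, 1 ≤ n → (dirichletMeanLaw n α = α ↔ ∀ z : ℂ, 0 < z.im →
        (n : ℂ) * stieltjesTransform α z * iteratedDeriv (n - 1) (stieltjesTransform α) z
          = iteratedDeriv n (stieltjesTransform α) z) := fun n hn => by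
      obtain ⟨m, rfl⟩ := Nat.exists_eq_add_of_le' hn
      rw [dirichletMeanLaw_eq_iff_stieltjesPow m hα]
      exact forall₂_congr fun z hz => (stieltjesTransform_ode_iff hz m).symm
    refine ⟨hiff, fun n hn h => ?_⟩
    rw [← hiff n (by omega), or_self] at h
    exact isRealCauchy_or_isRealDirac_iff.2 ((dirichletMeanLaw_eq_iff_cauchyMeasure hn hα).1 h)
  · simpa using dirichletMeanLaw_eq_iff_isCauchy (n := 1) (.inl rfl) hα
  · simpa using dirichletMeanLaw_eq_iff_isCauchy (n := 2) (.inr rfl) hα
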